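/- For real numbers $U_1,\dots,U_n$ let $U_{(1)}\le\dots\le U_{(n)}$ be their increasing rearrangement, $\Delta_i:=U_{(i+1)}-U_{(i)}$ ($1\le i\le n-1$) their spacings, $\bar U:=\frac1n\sum_{i=1}^n U_i$ their mean, and $W_n:=\#\{i\le n: U_i>\bar U\}$. A probability distribution $\nu$ on $(0,\infty)$ is called positive strictly stable of index $\alpha$ if, for $X_1,X_2,\dots$ i.i.d. with law $\nu$, $X_1+\dots+X_m$ has the same law as $m^{1/\alpha}X_1$ for every $m\ge1$. For $\alpha\in(0,1)$ and $k\ge 0$ put $s_k:=\sum_{j=1}^k j^\alpha$. (i) Let $\alpha\in(0,1)$ and let $\nu$ be positive strictly stable of index $\alpha$. Then there is $c>0$ with $\int e^{-tx}\,d\nu(x)=e^{-ct^\alpha}$ for all $t\ge0$. Let further $n\ge2$ and let $U_1,\dots,U_n$ be random variables whose spacings $\Delta_1,\dots,\Delta_{n-1}$ are i.i.d. with law $\nu$, and let $D_1,D_2$ be independent random variables with law $\nu$ (for $n\ge3$ one may take $D_1=\Delta_1$, $D_2=\Delta_2$). Then for $0\le k\le n-1$ $$\mathbb P(W_n\le k)=\mathbb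 P\bigl(s_k^{1/\alpha}D_1\ge s_{n-k-1}^{1/\alpha}D_2\bigr),$$ for $0\le k\le n-2$ this equals $$\mathbb P\Bigl(\frac{D_2}{D_1}\le\Bigl(\frac{s_k}{s_{n-k-1}}\Bigr)^{1/\alpha}\Bigr),$$ and $\mathbb P(W_n\le n-1)=1$. (ii) If moreover $\alpha=1/2$ (the Lévy distribution), then for $0\le k\le n-2$ $$\mathbb P(W_n\le k)=\frac2\pi\arctan\frac{\sum_{j=1}^k\sqrt j}{\sum_{j=1}^{n-k-1}\sqrt j}.$$ (iii) There is a probability distribution on $\mathbb R$ with distribution function $F(x)=0$ for $x<0$, $F(x)=\frac2\pi\arctan\bigl(\bigl(\frac{x}{1-x}\bigr)^{3/2}\bigr)$ for $0\le x<1$, $F(x)=1$ for $x\ge1$, and with density $\frac3\pi\cdot\frac{\sqrt{x(1-x)}}{x^3+(1-x)^3}$ on $(0,1)$ and $0$ elsewhere, such that the following holds. If for every $n$ the variables $U_1,\dots,U_n$ (which may depend on $n$) have i.i.d. spacings with a positive strictly stable law of index $1/2$ (which may depend on $n$), then $W_n/n$ converges in law to this distribution as $n\to\infty$. -/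

import Mathlib

open MeasureTheory ProbabilityTheory Filter Topology

/-- The order statistics `U₍₁₎ ≤ ⋯ ≤ U₍ₙ₎` of a finite family of reals (indexed from `0`). -/
noncomputable def orderStat {n : ℕ} (u : Fin n → ℝ) : Fin n → ℝ :=
  u ∘ Tuple.sort u

/-- The spacings `Δᵢ = U₍ᵢ₊₁₎ - U₍ᵢ₎` (indexed from `0`, so there are `n - 1` of them). -/
noncomputable def spacing {n : ℕ} (u : Fin n → ℝ) (i : Fin (n - 1)) : ℝ :=
  orderStat u ⟨(i : ℕ) + 1, by omega⟩ - orderStat u ⟨(i : ℕ), by omega⟩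

/-- The number of the reals `u₁, …, uₙ` that exceed their arithmetic mean. -/
noncomputable def numAboveMean {n : ℕ} (u : Fin n → ℝ) : ℕ :=
  (Finset.univ.filter fun i => (∑ j, u j) / (n : ℝ) < u i).card

/-- `ν` is a positive strictly stable distribution of index `α`: a probability measure carried by
`(0, ∞)` such that, for `X₁, X₂, …` i.i.d. with law `ν`, the sum `X₁ + ⋯ + Xₘ` has the same law as
`m ^ (1 / α) * X₁`, for every `m ≥ 1`. -/
structure IsPositiveStable (α : ℝ) (ν : Measure ℝ) : Prop where
  isProbabilityMeasure : IsProbabilityMeasure ν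
  pos : ∀ᵐ x ∂ν, 0 < x
  map_sum : ∀ m : ℕ, 1 ≤ m →
    (Measure.pi fun _ : Fin m => ν).map (fun x => ∑ i, x i) =
      ν.map (fun x => (m : ℝ) ^ (1 / α) * x)

/-- The real random variables `U₁, …, Uₙ` have i.i.d. spacings with common law `ν`. -/
structure HasIIDSpacings {n : ℕ} {Ω : Type*} [MeasurableSpace Ω] (U : Fin n → Ω → ℝ)
    (ν : Measure ℝ) (μ : Measure Ω) : Prop where
  measurable : ∀ i, Measurable (U i)
  indep : iIndepFun (fun (i : Fin (n - 1)) ω => spacing (fun j => U j ω) i) μ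
  law : ∀ i : Fin (n - 1), HasLaw (fun ω => spacing (fun j => U j ω) i) ν μ

/-- `s_k = ∑_{j=1}^k j ^ α`. -/
noncomputable def powSum (α : ℝ) (k : ℕ) : ℝ :=
  ∑ j ∈ Finset.Icc 1 k, (j : ℝ) ^ α

/-! Write `n = m + k + 1`. At most `k` values exceed the mean exactly when the order statistic of
0-based index `m` is at most the mean, that is, when its total excess over the `m` smaller values is
at most the total excess of the `k` larger values over it. Summation by parts turns this into a
comparison of the lower `m` spacings with weights `1, …, m` and the upper `k` spacings with weights
`k, …, 1` (`numAboveMean_le_iff`). The two sides use disjoint blocks of spacings, so they are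
independent, and stability makes each a multiple of one variable, with factors `powSum α m ^ (1 /
α)` and `powSum α k ^ (1 / α)` (`IsPositiveStable.hasLaw_sum`). That step rests on the Laplace
transform `exp (-c t ^ α)` and on the uniqueness theorem `ext_of_laplace_eq`.

For `α = 1/2` the transform is that of `a / N ^ 2` with `N` standard Gaussian. The ratio of two
independent copies is therefore a squared Cauchy variable, which gives the arctangent. Since `∑ √j`
up to `k` grows like `2/3 * k ^ (3/2)`, the distribution functions of `W_n / n` converge pointwise,
hence the laws converge weakly. -/

/-! ### Uniqueness of Laplace transforms on the half-line. -/

/-- The complex moment generating function of `exp (-x)`, in terms of the Laplace transform at the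
natural numbers. -/
lemma complexMGF_exp_neg_eq_tsum {μ : Measure ℝ} [IsProbabilityMeasure μ]
    (hμ : ∀ᵐ x ∂μ, 0 ≤ x) (z : ℂ) :
    complexMGF (fun x => Real.exp (-x)) μ z =
      ∑' k : ℕ, z ^ k / (k.factorial : ℂ) * ((∫ x, Real.exp (-((k : ℝ) * x)) ∂μ : ℝ) : ℂ) := by
  have key : HasSum
      (fun k : ℕ => ∫ x, z ^ k / (k.factorial : ℂ) * ((Real.exp (-((k : ℝ) * x)) : ℝ) : ℂ) ∂μ)
      (∫ x, Complex.exp (z * ((Real.exp (-x) : ℝ) : ℂ)) ∂μ) := by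
    -- The exponential series is integrated term by term; `exp (-k x) ≤ 1` almost surely gives a
    -- summable dominating sequence.
    refine hasSum_integral_of_dominated_convergence
      (fun k _ => ‖z‖ ^ k / (k.factorial : ℝ)) (fun k => ?_) (fun k => ?_) ?_ ?_ ?_
    · exact Measurable.aestronglyMeasurable (by fun_prop)
    · filter_upwards [hμ] with x hx
      rw [norm_mul, norm_div, norm_pow, Complex.norm_natCast, Complex.norm_real,
        Real.norm_of_nonneg (Real.exp_pos _).le]
      refine mul_le_of_le_one_right (by positivity) ?_
      rw [Real.exp_le_one_iff]
      have : 0 ≤ (k : ℝ) * x := by positivity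
      linarith
    · exact ae_of_all _ fun _ => Real.summable_pow_div_factorial _
    · exact integrable_const _
    · refine ae_of_all _ fun x => ?_
      have h := NormedSpace.expSeries_div_hasSum_exp (z * ((Real.exp (-x) : ℝ) : ℂ))
      rw [← Complex.exp_eq_exp_ℂ] at h
      have e : (fun k : ℕ => z ^ k / (k.factorial : ℂ) * ((Real.exp (-((k : ℝ) * x)) : ℝ) : ℂ)) =
          fun k : ℕ => (z * ((Real.exp (-x) : ℝ) : ℂ)) ^ k / (k.factorial : ℂ) := by
        ext k
        rw [mul_pow, ← Complex.ofReal_pow, ← Real.exp_nat_mul, mul_neg]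
        ring
      rw [e]
      exact h
  rw [complexMGF, ← key.tsum_eq]
  refine tsum_congr fun k => ?_
  rw [integral_const_mul, integral_complex_ofReal]

/-- A probability law on `[0, ∞)` is determined by its Laplace transform. -/
theorem ext_of_laplace_eq {μ ν : Measure ℝ} [IsProbabilityMeasure μ] [IsProbabilityMeasure ν]
    (hμ : ∀ᵐ x ∂μ, 0 ≤ x) (hν : ∀ᵐ x ∂ν, 0 ≤ x)
    (h : ∀ t : ℝ, 0 ≤ t → mgf id μ (-t) = mgf id ν (-t)) : μ = ν := by
  -- The image under `exp (-x)` has the Laplace transform at the naturals as its moments, which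
  -- determine it; `-log` then undoes the map.
  have h1 : μ.map (fun x => Real.exp (-x)) = ν.map (fun x => Real.exp (-x)) := by
    refine Measure.ext_of_complexMGF_eq (by fun_prop) (by fun_prop) ?_
    ext z
    rw [complexMGF_exp_neg_eq_tsum hμ, complexMGF_exp_neg_eq_tsum hν]
    refine tsum_congr fun k => ?_
    have := h k (by positivity)
    simp only [mgf, id, neg_mul] at this
    rw [this]
  have h2 : ∀ ρ : Measure ℝ, (ρ.map fun x => Real.exp (-x)).map (fun y => -Real.log y) = ρ := by
    intro ρ
    rw [Measure.map_map (by fun_prop) (by fun_prop)]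
    convert Measure.map_id using 2
    ext x
    simp
  rw [← h2 μ, h1, h2]

/-! ### The Laplace transform of a positive stable law. -/

lemma integrable_exp_neg_mul_of_nonneg {ν : Measure ℝ} [IsFiniteMeasure ν]
    (hν : ∀ᵐ x ∂ν, 0 ≤ x) {t : ℝ} (ht : 0 ≤ t) :
    Integrable (fun x => Real.exp (-t * x)) ν := by
  refine Integrable.of_bound (Measurable.aestronglyMeasurable (by fun_prop)) 1 ?_
  filter_upwards [hν] with x hx
  rw [Real.norm_of_nonneg (Real.exp_pos _).le, Real.exp_le_one_iff]
  have := mul_nonneg ht hx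
  linarith

lemma mgf_sum_pi (ν : Measure ℝ) [IsProbabilityMeasure ν] (m : ℕ) (s : ℝ) :
    mgf (fun x : Fin m → ℝ => ∑ i, x i) (Measure.pi fun _ : Fin m => ν) s = mgf id ν s ^ m := by
  have hind : iIndepFun (fun (i : Fin m) (x : Fin m → ℝ) => x i)
      (Measure.pi fun _ : Fin m => ν) :=
    iIndepFun_pi (X := fun _ : Fin m => (id : ℝ → ℝ)) (fun _ => aemeasurable_id)
  have := hind.mgf_sum₀ (fun i => (measurable_pi_apply i).aemeasurable) (t := s) Finset.univ
  have e : (fun x : Fin m → ℝ => ∑ i, x i) =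
      ∑ i ∈ Finset.univ, fun x : Fin m → ℝ => x i := by
    ext x; simp
  rw [e, this]
  have : ∀ i : Fin m, mgf (fun x : Fin m → ℝ => x i) (Measure.pi fun _ : Fin m => ν) s
      = mgf id ν s := fun i => by
    conv_rhs => rw [← (measurePreserving_eval (fun _ : Fin m => ν) i).map_eq]
    rw [mgf_id_map (measurable_pi_apply i).aemeasurable]
  simp [this]

/-- A monotone function on `[0, ∞)` that commutes with multiplication by positive integers is
linear. -/
lemma eq_mul_of_monotone_of_nat_mul {h : ℝ → ℝ} (hmono : ∀ x y, 0 ≤ x → x ≤ y → h x ≤ h y)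
    (hmul : ∀ m : ℕ, 1 ≤ m → ∀ x, 0 ≤ x → h (m * x) = m * h x) {u : ℝ} (hu : 0 ≤ u) :
    h u = u * h 1 := by
  have h0 : h 0 = 0 := by
    have := hmul 2 (by norm_num) 0 le_rfl
    simp only [mul_zero] at this
    push_cast at this
    linarith
  have hnat : ∀ m : ℕ, h m = m * h 1 := by
    intro m
    rcases Nat.eq_zero_or_pos m with rfl | hm
    · simp [h0]
    · simpa using hmul m hm 1 zero_le_one
  have h1 : 0 ≤ h 1 := h0 ▸ hmono 0 1 le_rfl zero_le_one
  -- The point `(N + 1) * u` lies between consecutive integers, where `h` is known; monotonicity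
  -- traps `(N + 1) * h u` in a window of width `h 1`, and so bounds the defect by `h 1 / (N + 1)`.
  have key : ∀ N : ℕ, |h u - u * h 1| * ((N : ℝ) + 1) ≤ h 1 := by
    intro N
    have hN : (0 : ℝ) < (N : ℝ) + 1 := by positivity
    have hx : 0 ≤ ((N : ℝ) + 1) * u := by positivity
    have hm := hmul (N + 1) (by omega) u hu
    push_cast at hm
    have hl := hmono _ _ (by positivity) (Nat.floor_le hx)
    have hr := hmono _ ((⌊((N : ℝ) + 1) * u⌋₊ + 1 : ℕ) : ℝ) hx
      (by push_cast; exact (Nat.lt_floor_add_one _).le)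
    rw [hnat, hm] at hl
    rw [hnat, hm] at hr
    push_cast at hr
    have f1 := mul_le_mul_of_nonneg_right (Nat.floor_le hx) h1
    have f2 := mul_le_mul_of_nonneg_right (Nat.lt_floor_add_one (((N : ℝ) + 1) * u)).le h1
    rw [← abs_of_pos hN, ← abs_mul, abs_le]
    constructor <;> nlinarith
  by_contra hne
  have hpos : 0 < |h u - u * h 1| := abs_pos.2 (sub_ne_zero.2 hne)
  obtain ⟨N, hN⟩ := exists_nat_gt (h 1 / |h u - u * h 1|)
  rw [div_lt_iff₀ hpos] at hN
  have := key N
  nlinarith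

/-- The Laplace transform of a positive strictly stable law. -/
theorem IsPositiveStable.exists_mgf_eq {α : ℝ} (hα : 0 < α) {ν : Measure ℝ}
    (hν : IsPositiveStable α ν) :
    ∃ c : ℝ, 0 < c ∧ ∀ t : ℝ, 0 ≤ t → mgf id ν (-t) = Real.exp (-(c * t ^ α)) := by
  have := hν.isProbabilityMeasure
  have hnn : ∀ᵐ x ∂ν, 0 ≤ x := hν.pos.mono fun x hx => hx.le
  have hint : ∀ t : ℝ, 0 ≤ t → Integrable (fun x => Real.exp (-t * x)) ν :=
    fun t ht => integrable_exp_neg_mul_of_nonneg hnn ht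
  have hpos : ∀ t : ℝ, 0 ≤ t → 0 < mgf id ν (-t) := fun t ht => mgf_pos (hint t ht)
  have hscale : ∀ m : ℕ, 1 ≤ m → ∀ t : ℝ,
      mgf id ν (-((m : ℝ) ^ (1 / α) * t)) = mgf id ν (-t) ^ m := by
    intro m hm t
    have h := congrArg (fun ρ => mgf id ρ (-t)) (hν.map_sum m hm)
    rw [mgf_id_map (Measurable.aemeasurable (by fun_prop)),
      mgf_id_map (Measurable.aemeasurable (by fun_prop)), mgf_sum_pi] at h
    rw [h, ← mul_neg]
    exact (mgf_const_mul (X := id) (μ := ν) (t := -t) _).symm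
  -- In the variable `u = t ^ α` the scaling by `m ^ (1 / α)` becomes multiplication by `m`, so `h`
  -- is additive enough to be linear; its slope `h 1` is the constant `c`.
  set h : ℝ → ℝ := fun u => -Real.log (mgf id ν (-(u ^ (1 / α)))) with hdef
  have hα' : 0 < 1 / α := by positivity
  have hlin : ∀ u : ℝ, 0 ≤ u → h u = u * h 1 := by
    intro u hu
    refine eq_mul_of_monotone_of_nat_mul ?_ ?_ hu
    · intro x y hx hxy
      have hy := hx.trans hxy
      simp only [hdef]
      refine neg_le_neg (Real.log_le_log (hpos _ (by positivity)) ?_)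
      refine integral_mono_ae (hint _ (by positivity)) (hint _ (by positivity)) ?_
      filter_upwards [hnn] with z hz
      have : x ^ (1 / α) ≤ y ^ (1 / α) := Real.rpow_le_rpow hx hxy hα'.le
      simp only [id]
      gcongr
    · intro m hm x hx
      simp only [hdef]
      rw [Real.mul_rpow (by positivity) hx, hscale m hm, Real.log_pow]
      ring
  refine ⟨h 1, ?_, fun t ht => ?_⟩
  · simp only [hdef, Real.one_rpow, Left.neg_pos_iff]
    refine Real.log_neg (hpos 1 zero_le_one) ?_
    have h1 : ∫ x, (1 - Real.exp (-1 * x)) ∂ν = 1 - mgf id ν (-1) := by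
      rw [integral_sub (integrable_const _) (hint 1 zero_le_one)]
      simp [mgf]
    have h2 : 0 < ∫ x, (1 - Real.exp (-1 * x)) ∂ν := by
      rw [integral_pos_iff_support_of_nonneg_ae]
      · have : ∀ᵐ x ∂ν, x ∈ Function.support fun x => 1 - Real.exp (-1 * x) := by
          filter_upwards [hν.pos] with x hx
          have : Real.exp (-1 * x) < 1 := by rw [Real.exp_lt_one_iff]; linarith
          simp only [Function.mem_support]
          linarith
        refine pos_iff_ne_zero.2 fun h0 => ?_
        obtain ⟨x, hx, hx'⟩ := (this.and (measure_eq_zero_iff_ae_notMem.1 h0)).exists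
        exact hx' hx
      · filter_upwards [hν.pos] with x hx
        have : Real.exp (-1 * x) < 1 := by rw [Real.exp_lt_one_iff]; linarith
        simp only [Pi.zero_apply]
        linarith
      · exact (integrable_const _).sub (hint 1 zero_le_one)
    linarith
  · have h1 := hlin (t ^ α) (by positivity)
    have h2 : (t ^ α) ^ (1 / α) = t := by
      rw [← Real.rpow_mul ht, mul_one_div_cancel hα.ne', Real.rpow_one]
    have h3 : h (t ^ α) = -Real.log (mgf id ν (-t)) := by simp only [hdef, h2]
    rw [h3] at h1
    rw [mul_comm, ← h1, neg_neg, Real.exp_log (hpos t ht)]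

/-! ### Order statistics, spacings and the count above the mean. -/

lemma orderStat_monotone {n : ℕ} (u : Fin n → ℝ) : Monotone (orderStat u) :=
  Tuple.monotone_sort u

lemma sum_orderStat {n : ℕ} (u : Fin n → ℝ) : ∑ i, orderStat u i = ∑ i, u i :=
  Equiv.sum_comp (Tuple.sort u) u

lemma spacing_nonneg {n : ℕ} (u : Fin n → ℝ) (i : Fin (n - 1)) : 0 ≤ spacing u i :=
  sub_nonneg.2 (orderStat_monotone u (by simp [Fin.le_def]))

lemma card_filter_orderStat {n : ℕ} (u : Fin n → ℝ) (p : ℝ → Prop) [DecidablePred p] :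
    (Finset.univ.filter fun i => p (orderStat u i)).card =
      (Finset.univ.filter fun i => p (u i)).card := by
  rw [Finset.card_filter, Finset.card_filter]
  exact Equiv.sum_comp (Tuple.sort u) fun i => if p (u i) then 1 else 0

/-- At most `k` values above the mean means at least `m + 1` values not above it, and the largest of
the `m + 1` smallest has 0-based index `m`. -/
lemma numAboveMean_le_iff_orderStat_le {m k : ℕ} (u : Fin (m + k + 1) → ℝ) :
    numAboveMean u ≤ k ↔
      orderStat u ⟨m, by omega⟩ ≤ (∑ j, u j) / ((m + k + 1 : ℕ) : ℝ) := by
  set a := (∑ j, u j) / ((m + k + 1 : ℕ) : ℝ) with ha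
  have h1 := card_filter_orderStat u (fun x => x ≤ a)
  have h2 := Finset.card_filter_add_card_filter_not (s := (Finset.univ : Finset (Fin (m + k + 1))))
    (fun i => u i ≤ a)
  simp only [not_le, Finset.card_univ, Fintype.card_fin] at h2
  rw [← Tuple.lt_card_le_iff_apply_le_of_monotone (orderStat_monotone u), h1]
  unfold numAboveMean
  rw [← ha]
  simp only
  omega

/-- Summation by parts: the gap after index `i` is crossed from each starting point `j ≤ i`, hence
`i + 1` times. -/
lemma sum_range_sub_last (v : ℕ → ℝ) (m : ℕ) :
    ∑ j ∈ Finset.range m, (v m - v j) =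
      ∑ i ∈ Finset.range m, ((i : ℝ) + 1) * (v (i + 1) - v i) := by
  induction m with
  | zero => simp
  | succ m ih =>
    rw [Finset.sum_range_succ, Finset.sum_range_succ, ← ih]
    simp only [Finset.sum_sub_distrib, Finset.sum_const, Finset.card_range, nsmul_eq_mul]
    ring

/-- The mirror image: the gap after index `i` is crossed on the way to each of the `k - i` later
endpoints. -/
lemma sum_range_sub_first (v : ℕ → ℝ) (k : ℕ) :
    ∑ j ∈ Finset.range k, (v (j + 1) - v 0) =
      ∑ i ∈ Finset.range k, ((k : ℝ) - i) * (v (i + 1) - v i) := by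
  induction k with
  | zero => simp
  | succ k ih =>
    rw [Finset.sum_range_succ, Finset.sum_range_succ, ih, ← Finset.sum_range_sub v,
      Finset.sum_range_succ]
    have : ∑ i ∈ Finset.range k, (((k + 1 : ℕ) : ℝ) - i) * (v (i + 1) - v i) =
        ∑ i ∈ Finset.range k, ((k : ℝ) - i) * (v (i + 1) - v i) +
          ∑ i ∈ Finset.range k, (v (i + 1) - v i) := by
      rw [← Finset.sum_add_distrib]
      refine Finset.sum_congr rfl fun i _ => ?_
      push_cast
      ring
    rw [this]
    push_cast
    ring

lemma sum_filter_val_lt (m k : ℕ) (f : ℕ → ℝ) :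
    ∑ i ∈ Finset.univ.filter (fun i : Fin (m + k) => (i : ℕ) < m), f i =
      ∑ i ∈ Finset.range m, f i := by
  rw [Finset.sum_filter, Fin.sum_univ_eq_sum_range (fun i => if i < m then f i else 0) (m + k),
    Finset.sum_range_add]
  simp only [add_lt_iff_neg_left, not_lt_zero, if_false, Finset.sum_const_zero, add_zero]
  exact Finset.sum_congr rfl fun i hi => if_pos (Finset.mem_range.1 hi)

lemma sum_filter_val_ge (m k : ℕ) (f : ℕ → ℝ) :
    ∑ i ∈ Finset.univ.filter (fun i : Fin (m + k) => ¬ (i : ℕ) < m), f i =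
      ∑ i ∈ Finset.range k, f (m + i) := by
  rw [Finset.sum_filter, Fin.sum_univ_eq_sum_range (fun i => if ¬ i < m then f i else 0) (m + k),
    Finset.sum_range_add]
  simp only [add_lt_iff_neg_left, not_lt_zero, not_false_eq_true, if_true]
  rw [Finset.sum_eq_zero fun i hi => if_neg (not_not.2 (Finset.mem_range.1 hi)), zero_add]

/-- The event that at most `k` of `m + k + 1` reals exceed their mean, in terms of spacings. -/
lemma numAboveMean_le_iff {m k : ℕ} (u : Fin (m + k + 1) → ℝ) :
    numAboveMean u ≤ k ↔
      ∑ i ∈ Finset.univ.filter (fun i : Fin (m + k) => (i : ℕ) < m),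
          ((i : ℝ) + 1) * spacing u i ≤
        ∑ i ∈ Finset.univ.filter (fun i : Fin (m + k) => ¬ (i : ℕ) < m),
          (((m + k : ℕ) : ℝ) - i) * spacing u i := by
  rw [numAboveMean_le_iff_orderStat_le, le_div_iff₀ (by positivity), ← sum_orderStat]
  -- Extending by `0` to all naturals makes the range identities applicable; the default value is
  -- never used.
  set v : ℕ → ℝ := fun j => if h : j < m + k + 1 then orderStat u ⟨j, h⟩ else 0 with hv
  have hsp : ∀ i : Fin (m + k), spacing u i = v (i + 1) - v i := by
    intro i
    have h1 : (i : ℕ) + 1 < m + k + 1 := by omega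
    have h2 : (i : ℕ) < m + k + 1 := by omega
    simp only [hv, h1, h2, dif_pos]
    rfl
  have hm : orderStat u ⟨m, by omega⟩ = v m := by
    have h1 : m < m + k + 1 := by omega
    simp only [hv, h1, dif_pos]
  have hsum : ∑ i, orderStat u i = ∑ i ∈ Finset.range (m + k + 1), v i := by
    rw [← Fin.sum_univ_eq_sum_range]
    refine Finset.sum_congr rfl fun i _ => ?_
    simp only [hv, i.2, dif_pos, Fin.eta]
  have hA := sum_filter_val_lt m k fun i => ((i : ℝ) + 1) * (v (i + 1) - v i)
  have hB := sum_filter_val_ge m k fun i => (((m + k : ℕ) : ℝ) - i) * (v (i + 1) - v i)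
  have hB' := sum_range_sub_first (fun i => v (m + i)) k
  have hB'' : ∑ i ∈ Finset.range k,
      (((m + k : ℕ) : ℝ) - (m + i : ℕ)) * (v (m + i + 1) - v (m + i)) =
        ∑ j ∈ Finset.range k, (v (m + (j + 1)) - v (m + 0)) := by
    rw [hB']
    refine Finset.sum_congr rfl fun i _ => ?_
    push_cast
    rw [add_assoc m i 1]
    ring
  have hA' := sum_range_sub_last v m
  simp only [hsp]
  rw [hm, hsum, hA, hB, hB'', ← hA', add_assoc, Finset.sum_range_add, Finset.sum_range_succ' _ k]
  simp only [Finset.sum_sub_distrib, Finset.sum_const, Finset.card_range, nsmul_eq_mul, add_zero]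
  push_cast
  constructor <;> intro h <;> linarith

lemma numAboveMean_le_pred {n : ℕ} (hn : 1 ≤ n) (u : Fin n → ℝ) : numAboveMean u ≤ n - 1 := by
  obtain ⟨k, rfl⟩ : ∃ k, n = 0 + k + 1 := ⟨n - 1, by omega⟩
  simp only [Nat.add_sub_cancel, Nat.zero_add]
  -- With `m = 0` the lower block is empty and the inequality is between `0` and a nonnegative sum.
  rw [numAboveMean_le_iff (m := 0)]
  simp only [not_lt_zero, Finset.filter_false, Finset.sum_empty, not_false_eq_true,
    Finset.filter_true]
  refine Finset.sum_nonneg fun i _ => mul_nonneg ?_ (spacing_nonneg u i)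
  have : (i : ℝ) ≤ ((0 + k : ℕ) : ℝ) := by exact_mod_cast i.2.le
  linarith

lemma measurable_numAboveMean {n : ℕ} {Ω : Type*} [MeasurableSpace Ω] {U : Fin n → Ω → ℝ}
    (hU : ∀ i, Measurable (U i)) : Measurable fun ω => numAboveMean fun i => U i ω := by
  unfold numAboveMean
  simp only [Finset.card_filter]
  refine Finset.measurable_fun_sum _ fun i _ => ?_
  exact Measurable.ite (measurableSet_lt (by fun_prop) (hU i)) measurable_const measurable_const

/-! ### Stable linear combinations and the law of the count. -/

lemma powSum_eq_sum_range (α : ℝ) (k : ℕ) :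
    powSum α k = ∑ i ∈ Finset.range k, ((i : ℝ) + 1) ^ α := by
  induction k with
  | zero => simp [powSum]
  | succ k ih =>
    rw [Finset.sum_range_succ, ← ih, powSum, Finset.sum_Icc_succ_top (by omega)]
    simp [powSum]

/-- The weights of the upper block occur in the order `k, …, 1`. -/
lemma powSum_eq_sum_range_sub (α : ℝ) (k : ℕ) :
    powSum α k = ∑ i ∈ Finset.range k, ((k : ℝ) - i) ^ α := by
  rw [powSum_eq_sum_range, ← Finset.sum_range_reflect]
  refine Finset.sum_congr rfl fun i hi => ?_
  have := Finset.mem_range.1 hi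
  have e : ((k - 1 - i : ℕ) : ℝ) + 1 = (k : ℝ) - i := by
    rw [Nat.sub_sub, Nat.cast_sub (by omega)]
    push_cast
    ring
  rw [e]

lemma powSum_nonneg (α : ℝ) (k : ℕ) : 0 ≤ powSum α k :=
  Finset.sum_nonneg fun j _ => by positivity

lemma powSum_pos (α : ℝ) {k : ℕ} (hk : 1 ≤ k) : 0 < powSum α k := by
  refine Finset.sum_pos (fun j hj => ?_) ⟨1, by simp [hk]⟩
  have : 0 < j := (Finset.mem_Icc.1 hj).1
  positivity

/-- A nonnegative linear combination of i.i.d. positive stable variables is, in law, a multiple of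
one of them. -/
theorem IsPositiveStable.hasLaw_sum {α : ℝ} (hα : 0 < α) {ν : Measure ℝ}
    (hν : IsPositiveStable α ν) {ι Ω : Type*} [MeasurableSpace Ω] {μ : Measure Ω}
    [IsProbabilityMeasure μ] {X : ι → Ω → ℝ} (hind : iIndepFun X μ)
    (hX : ∀ i, HasLaw (X i) ν μ) (S : Finset ι) (a : ι → ℝ) (ha : ∀ i ∈ S, 0 ≤ a i) :
    HasLaw (fun ω => ∑ i ∈ S, a i * X i ω)
      (ν.map fun x => (∑ i ∈ S, a i ^ α) ^ (1 / α) * x) μ := by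
  have := hν.isProbabilityMeasure
  have hXm : ∀ i, AEMeasurable (X i) μ := fun i => (hX i).aemeasurable
  have hm : AEMeasurable (fun ω => ∑ i ∈ S, a i * X i ω) μ :=
    Finset.aemeasurable_fun_sum _ fun i _ => (hXm i).const_mul _
  refine ⟨hm, ?_⟩
  have hm' : Measurable fun x : ℝ => (∑ i ∈ S, a i ^ α) ^ (1 / α) * x := by fun_prop
  have := Measure.isProbabilityMeasure_map (μ := μ) hm
  have := Measure.isProbabilityMeasure_map (μ := ν) hm'.aemeasurable
  have hs : 0 ≤ ∑ i ∈ S, a i ^ α := Finset.sum_nonneg fun i hi => Real.rpow_nonneg (ha i hi) _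
  obtain ⟨c, -, hc⟩ := hν.exists_mgf_eq hα
  -- Both transforms equal `exp (-c (∑ a i ^ α) t ^ α)`.
  refine ext_of_laplace_eq ?_ ?_ fun t ht => ?_
  · rw [ae_map_iff hm measurableSet_Ici]
    have : ∀ i ∈ S, ∀ᵐ ω ∂μ, 0 < X i ω := fun i _ =>
      ((hX i).ae_iff (p := fun x => 0 < x) (measurableSet_setOfPred.1 measurableSet_Ioi)).2 hν.pos
    filter_upwards [(Finset.eventually_all S).2 this] with ω hω
    exact Finset.sum_nonneg fun i hi => mul_nonneg (ha i hi) (hω i hi).le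
  · rw [ae_map_iff hm'.aemeasurable measurableSet_Ici]
    filter_upwards [hν.pos] with x hx
    exact mul_nonneg (Real.rpow_nonneg hs _) hx.le
  · rw [mgf_id_map hm, mgf_id_map hm'.aemeasurable]
    have h1 : mgf (fun x : ℝ => (∑ i ∈ S, a i ^ α) ^ (1 / α) * x) ν (-t) =
        Real.exp (-(c * ((∑ i ∈ S, a i ^ α) * t ^ α))) := by
      rw [show mgf (fun x : ℝ => (∑ i ∈ S, a i ^ α) ^ (1 / α) * x) ν (-t) = _ from
        mgf_const_mul (X := id) (μ := ν) (t := -t) _, mul_neg, hc _ (by positivity),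
        Real.mul_rpow (by positivity) ht, ← Real.rpow_mul hs, one_div_mul_cancel hα.ne',
        Real.rpow_one]
    have hind' : iIndepFun (fun i ω => a i * X i ω) μ :=
      hind.comp (fun i x => a i * x) fun i => by fun_prop
    have h2 := hind'.mgf_sum₀ (fun i => (hXm i).const_mul _) (t := -t) S
    have e : (fun ω => ∑ i ∈ S, a i * X i ω) = ∑ i ∈ S, fun ω => a i * X i ω := by
      ext ω; simp
    rw [h1, e, h2]
    have h3 : ∀ i ∈ S, mgf (fun ω => a i * X i ω) μ (-t) =
        Real.exp (-(c * (a i ^ α * t ^ α))) := by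
      intro i hi
      rw [mgf_const_mul, mul_neg, ← Real.mul_rpow (ha i hi) ht, ← hc _ (mul_nonneg (ha i hi) ht),
        ← (hX i).map_eq, mgf_id_map (hXm i)]
    rw [Finset.prod_congr rfl h3, ← Real.exp_sum, Finset.sum_neg_distrib, ← Finset.mul_sum,
      ← Finset.sum_mul]

lemma indepFun_sum_of_disjoint {ι Ω : Type*} [MeasurableSpace Ω] {μ : Measure Ω}
    {X : ι → Ω → ℝ} (hind : iIndepFun X μ) (hX : ∀ i, AEMeasurable (X i) μ) {S T : Finset ι}
    (hST : Disjoint S T) (a b : ι → ℝ) :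
    IndepFun (fun ω => ∑ i ∈ S, a i * X i ω) (fun ω => ∑ i ∈ T, b i * X i ω) μ := by
  have h := (hind.indepFun_finset₀ S T hST hX).comp
    (φ := fun x : S → ℝ => ∑ i : S, a i * x i) (ψ := fun x : T → ℝ => ∑ i : T, b i * x i)
    (by fun_prop) (by fun_prop)
  convert h using 1
  · ext ω
    simp only [Function.comp_apply]
    exact (Finset.sum_coe_sort S fun i => a i * X i ω).symm
  · ext ω
    simp only [Function.comp_apply]
    exact (Finset.sum_coe_sort T fun i => b i * X i ω).symm

/-- The distribution of the number of variables above the mean, for positive stable spacings. -/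
theorem measureReal_numAboveMean_le {α : ℝ} (hα : 0 < α) {ν : Measure ℝ}
    (hν : IsPositiveStable α ν) {m k : ℕ} {Ω Ω' : Type*} [MeasurableSpace Ω] {μ : Measure Ω}
    [IsProbabilityMeasure μ] {U : Fin (m + k + 1) → Ω → ℝ} (hU : HasIIDSpacings U ν μ)
    [MeasurableSpace Ω'] {P : Measure Ω'} [IsProbabilityMeasure P] {D₁ D₂ : Ω' → ℝ}
    (h₁ : HasLaw D₁ ν P) (h₂ : HasLaw D₂ ν P) (hD : IndepFun D₁ D₂ P) :
    μ.real {ω | numAboveMean (fun i => U i ω) ≤ k} =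
      P.real {ω | powSum α m ^ (1 / α) * D₂ ω ≤ powSum α k ^ (1 / α) * D₁ ω} := by
  simp only [numAboveMean_le_iff]
  have hind : iIndepFun (fun (i : Fin (m + k)) ω => spacing (fun j => U j ω) i) μ := hU.indep
  have hlaw : ∀ i : Fin (m + k), HasLaw (fun ω => spacing (fun j => U j ω) i) ν μ := hU.law
  set S := Finset.univ.filter fun i : Fin (m + k) => (i : ℕ) < m with hS
  set T := Finset.univ.filter fun i : Fin (m + k) => ¬ (i : ℕ) < m with hT
  have hST : Disjoint S T := Finset.disjoint_filter_filter_not _ _ _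
  have hA := hν.hasLaw_sum hα hind hlaw S (fun i => (i : ℝ) + 1) fun i _ => by positivity
  have hB := hν.hasLaw_sum hα hind hlaw T (fun i => ((m + k : ℕ) : ℝ) - i) fun i _ => by
    have : (i : ℝ) ≤ ((m + k : ℕ) : ℝ) := by exact_mod_cast i.2.le
    linarith
  have hAB := indepFun_sum_of_disjoint hind (fun i => (hlaw i).aemeasurable) hST
    (fun i => (i : ℝ) + 1) (fun i => ((m + k : ℕ) : ℝ) - i)
  rw [hS, sum_filter_val_lt m k fun i => ((i : ℝ) + 1) ^ α, ← powSum_eq_sum_range] at hA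
  rw [hT, sum_filter_val_ge m k fun i => (((m + k : ℕ) : ℝ) - i) ^ α] at hB
  have e : ∑ i ∈ Finset.range k, (((m + k : ℕ) : ℝ) - ((m + i : ℕ) : ℝ)) ^ α = powSum α k := by
    rw [powSum_eq_sum_range_sub]
    refine Finset.sum_congr rfl fun i _ => ?_
    push_cast
    rw [add_sub_add_left_eq_sub]
  rw [e] at hB
  have := hν.isProbabilityMeasure
  have hscale : ∀ (a : ℝ) {D : Ω' → ℝ}, HasLaw D ν P →
      HasLaw (fun ω => a * D ω) (ν.map fun x => a * x) P := fun a D h =>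
    HasLaw.fun_comp (Y := fun x => a * x) ⟨by fun_prop, rfl⟩ h
  -- Equal marginals and independence give the two pairs the same product law, so they charge the
  -- half-plane `p.1 ≤ p.2` equally.
  have hp1 := (indepFun_iff_hasLaw_prodMk_prod hA hB).1 hAB
  have hp2 := (indepFun_iff_hasLaw_prodMk_prod (hscale (powSum α m ^ (1 / α)) h₂)
    (hscale (powSum α k ^ (1 / α)) h₁)).1
    (hD.symm.comp (φ := fun x => powSum α m ^ (1 / α) * x)
      (ψ := fun x => powSum α k ^ (1 / α) * x) (by fun_prop) (by fun_prop))
  have hmeas : MeasurableSet {p : ℝ × ℝ | p.1 ≤ p.2} := measurableSet_le (by fun_prop) (by fun_prop)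
  exact (hp1.measureReal_eq hmeas).trans (hp2.measureReal_eq hmeas).symm

/-- Two-variable comparison events, in terms of the ratio of the variables. -/
lemma measureReal_mul_le_mul_eq_ratio {α : ℝ} {ν : Measure ℝ}
    (hν : IsPositiveStable α ν) {m k : ℕ} (hm : 1 ≤ m) {Ω' : Type*} [MeasurableSpace Ω']
    {P : Measure Ω'} {D₁ D₂ : Ω' → ℝ} (h₁ : HasLaw D₁ ν P) :
    P.real {ω | powSum α m ^ (1 / α) * D₂ ω ≤ powSum α k ^ (1 / α) * D₁ ω} =
      P.real {ω | D₂ ω / D₁ ω ≤ (powSum α k / powSum α m) ^ (1 / α)} := by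
  refine measureReal_congr ?_
  have hpos : ∀ᵐ ω ∂P, 0 < D₁ ω :=
    (h₁.ae_iff (p := fun x => 0 < x) (measurableSet_setOfPred.1 measurableSet_Ioi)).2 hν.pos
  filter_upwards [hpos] with ω hω
  have hs := Real.rpow_pos_of_pos (powSum_pos α hm) (1 / α)
  refine propext ?_
  change _ ≤ _ ↔ _ ≤ _
  rw [Real.div_rpow (powSum_nonneg _ _) (powSum_nonneg _ _), div_le_div_iff₀ hω hs, mul_comm]

/-! ### The Lévy law and the ratio of two Gaussians. -/

/-- The Cauchy–Schlömilch substitution `y = x - b / x` for a Gaussian integral. -/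
lemma integral_exp_neg_sub_div_sq {b : ℝ} (hb : 0 < b) :
    ∫ x in Set.Ioi (0 : ℝ), Real.exp (-(1 / 2) * (x - b / x) ^ 2) = √(2 * Real.pi) / 2 := by
  set g : ℝ → ℝ := fun y => Real.exp (-(1 / 2) * y ^ 2) with hg
  have hderiv : ∀ x ∈ Set.Ioi (0 : ℝ),
      HasDerivWithinAt (fun x => x - b / x) (1 + b / x ^ 2) (Set.Ioi 0) x := by
    intro x hx
    have hx0 : x ≠ 0 := ne_of_gt hx
    simp only [div_eq_mul_inv]
    exact ((hasDerivAt_id' x).sub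
      ((hasDerivAt_inv hx0).const_mul b)).hasDerivWithinAt.congr_deriv (by ring)
  have hinj : Set.InjOn (fun x => x - b / x) (Set.Ioi 0) := by
    refine StrictMonoOn.injOn fun x hx y hy hxy => ?_
    have : b / y < b / x := div_lt_div_of_pos_left hb hx hxy
    linarith
  have himg : (fun x => x - b / x) '' Set.Ioi 0 = Set.univ := by
    refine Set.eq_univ_of_forall fun y => ?_
    have hs : |y| < √(y ^ 2 + 4 * b) := by
      rw [← Real.sqrt_sq_eq_abs]
      exact Real.sqrt_lt_sqrt (sq_nonneg y) (by linarith)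
    have hpos : 0 < (y + √(y ^ 2 + 4 * b)) / 2 := by
      have := neg_abs_le y
      linarith
    -- The preimage of `y` is the positive root of `x ^ 2 - y * x - b = 0`.
    refine ⟨_, hpos, ?_⟩
    have hsq : √(y ^ 2 + 4 * b) ^ 2 = y ^ 2 + 4 * b := Real.sq_sqrt (by positivity)
    have : y + √(y ^ 2 + 4 * b) ≠ 0 := by linarith
    simp only
    field_simp
    linear_combination hsq
  have hgi : Integrable g := integrable_exp_neg_mul_sq (by norm_num)
  have h1 := integral_image_eq_integral_abs_deriv_smul measurableSet_Ioi hderiv hinj g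
  have h1i := (integrableOn_image_iff_integrableOn_abs_deriv_smul measurableSet_Ioi hderiv hinj
    g).1 hgi.integrableOn
  have hderiv' : ∀ x ∈ Set.Ioi (0 : ℝ),
      HasDerivWithinAt (fun x => b / x) (-(b / x ^ 2)) (Set.Ioi 0) x := by
    intro x hx
    have hx0 : x ≠ 0 := ne_of_gt hx
    simp only [div_eq_mul_inv]
    exact ((hasDerivAt_inv hx0).const_mul b).hasDerivWithinAt.congr_deriv (by ring)
  have hinj' : Set.InjOn (fun x => b / x) (Set.Ioi 0) := by
    refine StrictAntiOn.injOn fun x hx y hy hxy => ?_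
    exact div_lt_div_of_pos_left hb hx hxy
  have himg' : (fun x => b / x) '' Set.Ioi 0 = Set.Ioi 0 := by
    ext y
    constructor
    · rintro ⟨x, hx, rfl⟩
      exact div_pos hb hx
    · intro hy
      refine ⟨b / y, div_pos hb hy, ?_⟩
      have : y ≠ 0 := ne_of_gt hy
      simp only
      field_simp
  -- The involution `x ↦ b / x` shows that the parts of `h1` with weights `1` and `b / x ^ 2` are
  -- equal, so each is half the Gaussian integral.
  have h2 := integral_image_eq_integral_abs_deriv_smul measurableSet_Ioi hderiv' hinj'
    fun x => g (x - b / x)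
  rw [himg'] at h2
  rw [himg, setIntegral_univ] at h1
  have e1 : ∀ x ∈ Set.Ioi (0 : ℝ), |1 + b / x ^ 2| • g (x - b / x) =
      g (x - b / x) + b / x ^ 2 * g (x - b / x) := by
    intro x hx
    rw [abs_of_nonneg (by positivity), smul_eq_mul]
    ring
  have e2 : ∀ x ∈ Set.Ioi (0 : ℝ), |-(b / x ^ 2)| • g (b / x - b / (b / x)) =
      b / x ^ 2 * g (x - b / x) := by
    intro x hx
    have hx0 : x ≠ 0 := ne_of_gt hx
    rw [abs_neg, abs_of_nonneg (by positivity), smul_eq_mul]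
    congr 1
    simp only [hg]
    congr 2
    field_simp
    ring
  rw [setIntegral_congr_fun measurableSet_Ioi e2] at h2
  rw [setIntegral_congr_fun measurableSet_Ioi e1] at h1
  have h1i' : IntegrableOn (fun x => g (x - b / x) + b / x ^ 2 * g (x - b / x)) (Set.Ioi 0) :=
    h1i.congr_fun e1 measurableSet_Ioi
  have hGi : IntegrableOn (fun x => g (x - b / x)) (Set.Ioi 0) := by
    refine Integrable.mono' h1i' (Measurable.aestronglyMeasurable (by fun_prop)) ?_
    refine ae_of_all _ fun x => ?_
    have hgp : 0 ≤ g (x - b / x) := (Real.exp_pos _).le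
    rw [Real.norm_of_nonneg hgp]
    have : 0 ≤ b / x ^ 2 * g (x - b / x) := by positivity
    linarith
  have hHi : IntegrableOn (fun x => b / x ^ 2 * g (x - b / x)) (Set.Ioi 0) := by
    have := h1i'.sub hGi
    refine this.congr (ae_of_all _ fun x => ?_)
    simp
  rw [integral_add hGi hHi, ← h2] at h1
  have h3 : ∫ x, g x = √(2 * Real.pi) := by
    simp only [hg]
    rw [integral_gaussian]
    congr 1
    ring
  rw [h3] at h1
  change ∫ x in Set.Ioi (0 : ℝ), g (x - b / x) = _
  linarith

/-- The Laplace transform of the law of `a / N²` for a standard Gaussian `N`. -/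
lemma mgf_div_sq_gaussianReal {c : ℝ} (hc : 0 < c) {t : ℝ} (ht : 0 ≤ t) :
    mgf (fun x => c ^ 2 / 2 / x ^ 2) (gaussianReal 0 1) (-t) = Real.exp (-(c * √t)) := by
  have hpi := Real.pi_pos
  have h2pi : 0 < √(2 * Real.pi) := by positivity
  rcases ht.eq_or_lt with rfl | ht
  · simp
  set b := c * √t with hb
  have hbpos : 0 < b := by positivity
  have hbsq : b ^ 2 = c ^ 2 * t := by rw [hb, mul_pow, Real.sq_sqrt ht.le]
  rw [mgf, integral_gaussianReal_eq_integral_smul one_ne_zero]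
  set f : ℝ → ℝ := fun x => (√(2 * Real.pi))⁻¹ * Real.exp (-(x ^ 2) / 2) *
    Real.exp (-t * (c ^ 2 / 2 / x ^ 2)) with hf
  have e : ∀ x, gaussianPDFReal 0 1 x • Real.exp (-t * (c ^ 2 / 2 / x ^ 2)) = f |x| := by
    intro x
    simp [gaussianPDFReal, hf, sq_abs]
  simp_rw [e]
  rw [integral_comp_abs]
  -- Completing the square in the exponent, with `b = c * √t`, leaves the factor `exp (-b)`.
  have e2 : ∀ x ∈ Set.Ioi (0 : ℝ), f x = (√(2 * Real.pi))⁻¹ * Real.exp (-b) *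
      Real.exp (-(1 / 2) * (x - b / x) ^ 2) := by
    intro x hx
    have hx0 : x ≠ 0 := ne_of_gt hx
    simp only [hf]
    rw [mul_assoc, mul_assoc, ← Real.exp_add, ← Real.exp_add]
    congr 2
    have : (x - b / x) ^ 2 = x ^ 2 - 2 * b + b ^ 2 / x ^ 2 := by
      field_simp
      ring
    rw [this, hbsq]
    field_simp
    ring
  rw [setIntegral_congr_fun measurableSet_Ioi e2, integral_const_mul,
    integral_exp_neg_sub_div_sq hbpos]
  field_simp

lemma ae_ne_zero_gaussianReal : ∀ᵐ x ∂(gaussianReal 0 1), x ≠ 0 := by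
  have := nullSingletonClass_gaussianReal (μ := 0) (v := 1) one_ne_zero
  exact (measure_eq_zero_iff_ae_notMem.1 (measure_singleton (0 : ℝ)))

/-- A positive strictly stable law of index `1 / 2` is a Lévy law: the law of `c² / (2 N²)` for a
standard Gaussian `N`. -/
theorem IsPositiveStable.exists_eq_map_gaussianReal {ν : Measure ℝ}
    (hν : IsPositiveStable (1 / 2) ν) :
    ∃ a : ℝ, 0 < a ∧ ν = (gaussianReal 0 1).map fun x => a / x ^ 2 := by
  have := hν.isProbabilityMeasure
  obtain ⟨c, hc, h⟩ := hν.exists_mgf_eq (by norm_num)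
  have hm : Measurable fun x : ℝ => c ^ 2 / 2 / x ^ 2 := by fun_prop
  have := Measure.isProbabilityMeasure_map (μ := gaussianReal 0 1) hm.aemeasurable
  refine ⟨c ^ 2 / 2, by positivity, ext_of_laplace_eq (hν.pos.mono fun x hx => hx.le) ?_ ?_⟩
  · rw [ae_map_iff hm.aemeasurable measurableSet_Ici]
    exact ae_of_all _ fun x => by positivity
  · intro t ht
    rw [h t ht, mgf_id_map hm.aemeasurable, mgf_div_sq_gaussianReal hc ht, Real.sqrt_eq_rpow]

/-- This is the density at `z` of the ratio of two Gaussians, integrated over the denominator `y`: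
the Cauchy density. -/
lemma lintegral_abs_mul_gaussianPDF_mul (z : ℝ) :
    ∫⁻ y, gaussianPDF 0 1 y * (ENNReal.ofReal |y| * gaussianPDF 0 1 (z * y)) =
      ENNReal.ofReal (Real.pi⁻¹ * (1 + z ^ 2)⁻¹) := by
  have hpi := Real.pi_pos
  have hb : 0 < (1 + z ^ 2) / 2 := by positivity
  set f : ℝ → ℝ := fun y => (2 * Real.pi)⁻¹ * (y * Real.exp (-((1 + z ^ 2) / 2) * y ^ 2)) with hf
  have e : ∀ y, gaussianPDF 0 1 y * (ENNReal.ofReal |y| * gaussianPDF 0 1 (z * y)) =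
      ENNReal.ofReal (f |y|) := by
    intro y
    rw [gaussianPDF, gaussianPDF, ← ENNReal.ofReal_mul (abs_nonneg y),
      ← ENNReal.ofReal_mul (gaussianPDFReal_nonneg _ _ _)]
    congr 1
    simp only [gaussianPDFReal, hf, sq_abs, NNReal.coe_one, mul_one, sub_zero]
    have h1 : √(2 * Real.pi) * √(2 * Real.pi) = 2 * Real.pi := Real.mul_self_sqrt (by positivity)
    have h2 : Real.exp (-((1 + z ^ 2) / 2) * y ^ 2) =
        Real.exp (-y ^ 2 / 2) * Real.exp (-(z * y) ^ 2 / 2) := by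
      rw [← Real.exp_add]
      congr 1
      ring
    have h3 : (2 * Real.pi)⁻¹ = (√(2 * Real.pi))⁻¹ * (√(2 * Real.pi))⁻¹ := by
      rw [← mul_inv, h1]
    rw [h2, h3]
    ring
  have hi : Integrable fun y => f |y| := by
    have := ((integrable_mul_exp_neg_mul_sq hb).const_mul (2 * Real.pi)⁻¹).abs
    refine this.congr (ae_of_all _ fun y => ?_)
    simp only [hf, abs_mul, sq_abs, Real.abs_exp]
    rw [abs_of_nonneg (by positivity : (0 : ℝ) ≤ (2 * Real.pi)⁻¹)]
  simp_rw [e]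
  rw [← ofReal_integral_eq_lintegral_ofReal hi (ae_of_all _ fun y => by
    simp only [hf, Pi.zero_apply]; positivity), integral_comp_abs]
  congr 1
  have h := integral_rpow_mul_exp_neg_mul_rpow (p := 2) (q := 1) two_pos (by norm_num) hb
  simp only [Real.rpow_one, Real.rpow_two] at h
  rw [integral_const_mul, h]
  norm_num [Real.rpow_neg_one, Real.Gamma_one]
  field_simp

lemma image_mul_right_Icc_neg {y r : ℝ} (hy : y ≠ 0) :
    (fun z => z * y) '' Set.Icc (-r) r = {x | |x| ≤ r * |y|} := by
  ext x
  have hy' : 0 < |y| := abs_pos.2 hy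
  simp only [Set.mem_image, Set.mem_Icc, Set.mem_ofPred_eq, ← abs_le]
  constructor
  · rintro ⟨z, hz, rfl⟩
    rw [abs_mul]
    gcongr
  · intro h
    refine ⟨x / y, ?_, div_mul_cancel₀ x hy⟩
    rwa [abs_div, div_le_iff₀ hy']

/-- The ratio of two independent standard Gaussian variables is Cauchy distributed. -/
theorem gaussianReal_prod_abs_le_mul_abs {r : ℝ} (hr : 0 ≤ r) :
    ((gaussianReal 0 1).prod (gaussianReal 0 1)).real {p | |p.1| ≤ r * |p.2|} =
      2 / Real.pi * Real.arctan r := by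
  have hmeas : MeasurableSet {p : ℝ × ℝ | |p.1| ≤ r * |p.2|} :=
    measurableSet_le (by fun_prop) (by fun_prop)
  have hsec : ∀ y : ℝ, y ≠ 0 → gaussianReal 0 1 {x | |x| ≤ r * |y|} =
      ∫⁻ z in Set.Icc (-r) r, ENNReal.ofReal |y| * gaussianPDF 0 1 (z * y) := by
    intro y hy
    rw [gaussianReal_apply 0 one_ne_zero, ← image_mul_right_Icc_neg hy,
      lintegral_image_eq_lintegral_abs_deriv_mul (f' := fun _ => y) measurableSet_Icc
        (fun x _ => by simpa using ((hasDerivAt_id x).mul_const y).hasDerivWithinAt)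
        (fun a _ b _ h => mul_right_cancel₀ hy h)]
  have h : ((gaussianReal 0 1).prod (gaussianReal 0 1)) {p | |p.1| ≤ r * |p.2|} =
      ENNReal.ofReal (2 / Real.pi * Real.arctan r) := by
    rw [Measure.prod_apply_symm hmeas]
    have h1 : ∀ᵐ y ∂(gaussianReal 0 1),
        gaussianReal 0 1 ((fun x => (x, y)) ⁻¹' {p : ℝ × ℝ | |p.1| ≤ r * |p.2|}) =
          ∫⁻ z in Set.Icc (-r) r, ENNReal.ofReal |y| * gaussianPDF 0 1 (z * y) := by
      filter_upwards [ae_ne_zero_gaussianReal] with y hy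
      exact hsec y hy
    have hm2 : Measurable fun p : ℝ × ℝ => ENNReal.ofReal |p.1| * gaussianPDF 0 1 (p.2 * p.1) := by
      fun_prop
    rw [lintegral_congr_ae h1, gaussianReal_of_var_ne_zero 0 one_ne_zero,
      lintegral_withDensity_eq_lintegral_mul _ (measurable_gaussianPDF 0 1)
        (hm2.lintegral_prod_right (ν := volume.restrict (Set.Icc (-r) r)))]
    have h2 : ∀ y : ℝ, (gaussianPDF 0 1 * fun y =>
        ∫⁻ z in Set.Icc (-r) r, ENNReal.ofReal |y| * gaussianPDF 0 1 (z * y)) y =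
        ∫⁻ z in Set.Icc (-r) r, gaussianPDF 0 1 y *
          (ENNReal.ofReal |y| * gaussianPDF 0 1 (z * y)) := by
      intro y
      rw [Pi.mul_apply, ← lintegral_const_mul _ (by fun_prop)]
    simp_rw [h2]
    rw [lintegral_lintegral_swap (Measurable.aemeasurable (by fun_prop))]
    simp_rw [lintegral_abs_mul_gaussianPDF_mul]
    have hi : Continuous fun z : ℝ => Real.pi⁻¹ * (1 + z ^ 2)⁻¹ := by
      refine continuous_const.mul (Continuous.inv₀ (by fun_prop) fun z => ?_)
      positivity
    have hpi := Real.pi_pos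
    rw [← ofReal_integral_eq_lintegral_ofReal (hi.integrableOn_Icc)
      (ae_of_all _ fun z => by simp only [Pi.zero_apply]; positivity),
      integral_Icc_eq_integral_Ioc, ← intervalIntegral.integral_of_le (by linarith),
      intervalIntegral.integral_const_mul, integral_inv_one_add_sq, Real.arctan_neg]
    congr 1
    ring
  rw [Measure.real, h, ENNReal.toReal_ofReal]
  have := Real.arctan_nonneg.2 hr
  positivity

/-- The distribution function of the ratio of two independent Lévy variables. -/
theorem IsPositiveStable.measureReal_ratio_le {ν : Measure ℝ} (hν : IsPositiveStable (1 / 2) ν)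
    {r : ℝ} (hr : 0 ≤ r) :
    (ν.prod ν).real {p | p.2 / p.1 ≤ r ^ 2} = 2 / Real.pi * Real.arctan r := by
  obtain ⟨a, ha, rfl⟩ := hν.exists_eq_map_gaussianReal
  have hm : Measurable fun x : ℝ => a / x ^ 2 := by fun_prop
  rw [Measure.map_prod_map _ _ hm hm, map_measureReal_apply (by fun_prop)
    (measurableSet_le (by fun_prop) (by fun_prop)), ← gaussianReal_prod_abs_le_mul_abs hr]
  refine measureReal_congr ?_
  have h1 : ∀ᵐ p ∂((gaussianReal 0 1).prod (gaussianReal 0 1)), p.1 ≠ 0 :=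
    Measure.quasiMeasurePreserving_fst.ae ae_ne_zero_gaussianReal
  have h2 : ∀ᵐ p ∂((gaussianReal 0 1).prod (gaussianReal 0 1)), p.2 ≠ 0 :=
    Measure.quasiMeasurePreserving_snd.ae ae_ne_zero_gaussianReal
  filter_upwards [h1, h2] with p hp1 hp2
  refine propext ?_
  change a / p.2 ^ 2 / (a / p.1 ^ 2) ≤ r ^ 2 ↔ |p.1| ≤ r * |p.2|
  have hp2' : 0 < p.2 ^ 2 := by positivity
  -- The scale `a` cancels and the Gaussians trade places, since each enters through its inverse
  -- square.
  have e : a / p.2 ^ 2 / (a / p.1 ^ 2) = p.1 ^ 2 / p.2 ^ 2 := by field_simp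
  rw [e, div_le_iff₀ hp2', ← mul_pow, sq_le_sq, abs_mul, abs_of_nonneg hr]

lemma powSum_half (k : ℕ) : powSum (1 / 2) k = ∑ j ∈ Finset.Icc 1 k, √(j : ℝ) := by
  simp only [powSum, Real.sqrt_eq_rpow]

/-- The distribution of the number of variables above the mean, for Lévy spacings. -/
theorem measureReal_numAboveMean_le_arctan {ν : Measure ℝ} (hν : IsPositiveStable (1 / 2) ν)
    {n : ℕ} {Ω : Type*} [MeasurableSpace Ω] {μ : Measure Ω} [IsProbabilityMeasure μ]
    {U : Fin n → Ω → ℝ} (hU : HasIIDSpacings U ν μ) {k : ℕ} (hk : k < n - 1) :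
    μ.real {ω | numAboveMean (fun i => U i ω) ≤ k} =
      2 / Real.pi * Real.arctan
        ((∑ j ∈ Finset.Icc 1 k, √(j : ℝ)) / ∑ j ∈ Finset.Icc 1 (n - k - 1), √(j : ℝ)) := by
  have := hν.isProbabilityMeasure
  obtain ⟨m, rfl⟩ : ∃ m, n = m + k + 1 := ⟨n - k - 1, by omega⟩
  have hm : 1 ≤ m := by omega
  have e : m + k + 1 - k - 1 = m := by omega
  rw [e, ← powSum_half, ← powSum_half]
  have hD₁ : HasLaw (Prod.fst : ℝ × ℝ → ℝ) ν (ν.prod ν) := measurePreserving_fst.hasLaw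
  have hD₂ : HasLaw (Prod.snd : ℝ × ℝ → ℝ) ν (ν.prod ν) := measurePreserving_snd.hasLaw
  have hD : IndepFun (Prod.fst : ℝ × ℝ → ℝ) Prod.snd (ν.prod ν) :=
    (indepFun_iff_hasLaw_prodMk_prod hD₁ hD₂).2 HasLaw.id
  rw [measureReal_numAboveMean_le (by norm_num) hν hU hD₁ hD₂ hD,
    measureReal_mul_le_mul_eq_ratio hν hm hD₁,
    ← hν.measureReal_ratio_le (div_nonneg (powSum_nonneg _ _) (powSum_nonneg _ _))]
  -- The exponent `1 / (1 / 2)` is the square in `measureReal_ratio_le`.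
  norm_num

/-! ### Asymptotics of sums of square roots. -/

lemma two_thirds_sqrt_cube_le_sum_sqrt (k : ℕ) :
    2 / 3 * √(k : ℝ) ^ 3 ≤ ∑ j ∈ Finset.Icc 1 k, √(j : ℝ) := by
  induction k with
  | zero => simp
  | succ k ih =>
    rw [Finset.sum_Icc_succ_top (by omega)]
    have ha := Real.sqrt_nonneg (k : ℝ)
    have hb := Real.sqrt_nonneg ((k + 1 : ℕ) : ℝ)
    have ha2 : √(k : ℝ) ^ 2 = k := Real.sq_sqrt (by positivity)
    have hb2 : √((k + 1 : ℕ) : ℝ) ^ 2 = k + 1 := by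
      rw [Real.sq_sqrt (by positivity)]; push_cast; ring
    generalize √(k : ℝ) = a at *
    generalize √((k + 1 : ℕ) : ℝ) = b at *
    have h1 : b ^ 2 - a ^ 2 = 1 := by linarith
    -- As `b ^ 2 - a ^ 2 = 1`, this product equals `3 * b - 2 * (b ^ 3 - a ^ 3)`, three times the
    -- slack of the induction step.
    have h2 : 0 ≤ (b - a) ^ 2 * (b + 2 * a) := by positivity
    have h3 : b = b * (b ^ 2 - a ^ 2) := by rw [h1, mul_one]
    nlinarith

lemma sum_sqrt_le_two_thirds_sqrt_cube (k : ℕ) :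
    ∑ j ∈ Finset.Icc 1 k, √(j : ℝ) ≤ 2 / 3 * √((k : ℝ) + 1) ^ 3 := by
  induction k with
  | zero => norm_num
  | succ k ih =>
    rw [Finset.sum_Icc_succ_top (by omega)]
    push_cast
    have ha := Real.sqrt_nonneg ((k : ℝ) + 1)
    have hb := Real.sqrt_nonneg ((k : ℝ) + 1 + 1)
    have ha2 : √((k : ℝ) + 1) ^ 2 = k + 1 := Real.sq_sqrt (by positivity)
    have hb2 : √((k : ℝ) + 1 + 1) ^ 2 = k + 1 + 1 := Real.sq_sqrt (by positivity)
    generalize √((k : ℝ) + 1) = a at *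
    generalize √((k : ℝ) + 1 + 1) = b at *
    have h1 : b ^ 2 - a ^ 2 = 1 := by linarith
    -- Here the product equals `2 * (b ^ 3 - a ^ 3) - 3 * a`.
    have h2 : 0 ≤ (b - a) ^ 2 * (2 * b + a) := by positivity
    have h3 : a = a * (b ^ 2 - a ^ 2) := by rw [h1, mul_one]
    nlinarith

lemma tendsto_sum_sqrt_div {κ : ℕ → ℕ} {x : ℝ}
    (h : Tendsto (fun n => (κ n : ℝ) / n) atTop (𝓝 x)) :
    Tendsto (fun n : ℕ => (∑ j ∈ Finset.Icc 1 (κ n), √(j : ℝ)) / √(n : ℝ) ^ 3) atTop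
      (𝓝 (2 / 3 * √x ^ 3)) := by
  have hcont : Continuous fun y : ℝ => 2 / 3 * √y ^ 3 := by fun_prop
  have h' : Tendsto (fun n => ((κ n : ℝ) + 1) / n) atTop (𝓝 x) := by
    have := h.add (tendsto_one_div_atTop_nhds_zero_nat (𝕜 := ℝ))
    simpa [add_div] using this
  refine tendsto_of_tendsto_of_tendsto_of_le_of_le ((hcont.tendsto x).comp h)
    ((hcont.tendsto x).comp h') (fun n => ?_) (fun n => ?_)
  · simp only [Function.comp_apply]
    rw [Real.sqrt_div (by positivity), div_pow, ← mul_div_assoc]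
    gcongr
    exact two_thirds_sqrt_cube_le_sum_sqrt _
  · simp only [Function.comp_apply]
    rw [Real.sqrt_div (by positivity), div_pow, ← mul_div_assoc]
    gcongr
    exact sum_sqrt_le_two_thirds_sqrt_cube _

lemma sqrt_pow_three {x : ℝ} (hx : 0 ≤ x) : √x ^ 3 = x ^ (3 / 2 : ℝ) := by
  rw [Real.sqrt_eq_rpow, ← Real.rpow_natCast, ← Real.rpow_mul hx]
  norm_num

lemma tendsto_sum_sqrt_ratio {x : ℝ} (hx0 : 0 ≤ x) (hx1 : x < 1) :
    Tendsto (fun n : ℕ => (∑ j ∈ Finset.Icc 1 ⌊x * n⌋₊, √(j : ℝ)) /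
        ∑ j ∈ Finset.Icc 1 (n - ⌊x * n⌋₊ - 1), √(j : ℝ)) atTop
      (𝓝 ((x / (1 - x)) ^ (3 / 2 : ℝ))) := by
  have h1 : Tendsto (fun n : ℕ => (⌊x * (n : ℝ)⌋₊ : ℝ) / n) atTop (𝓝 x) :=
    (tendsto_nat_floor_mul_div_atTop hx0).comp tendsto_natCast_atTop_atTop
  -- Because `x < 1`, the truncated subtraction `n - ⌊x * n⌋₊ - 1` is eventually a true one.
  have hlt : ∀ᶠ n : ℕ in atTop, ⌊x * (n : ℝ)⌋₊ + 1 ≤ n := by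
    filter_upwards [eventually_ge_atTop 1] with n hn
    have hn' : (0 : ℝ) < n := by exact_mod_cast hn
    rw [Nat.succ_le_iff, Nat.floor_lt (by positivity)]
    nlinarith
  have h2 : Tendsto (fun n : ℕ => ((n - ⌊x * (n : ℝ)⌋₊ - 1 : ℕ) : ℝ) / n) atTop (𝓝 (1 - x)) := by
    have h := ((tendsto_const_nhds (x := (1 : ℝ))).sub h1).sub
      (tendsto_one_div_atTop_nhds_zero_nat (𝕜 := ℝ))
    rw [sub_zero] at h
    refine h.congr' ?_
    filter_upwards [hlt, eventually_ge_atTop 1] with n hn hn1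
    have hn' : (n : ℝ) ≠ 0 := by positivity
    rw [Nat.sub_sub, Nat.cast_sub hn]
    push_cast
    field_simp
    ring
  have h1x : 0 < 1 - x := by linarith
  have h3 := (tendsto_sum_sqrt_div h1).div (tendsto_sum_sqrt_div h2) (by positivity)
  have e : 2 / 3 * √x ^ 3 / (2 / 3 * √(1 - x) ^ 3) = (x / (1 - x)) ^ (3 / 2 : ℝ) := by
    rw [← sqrt_pow_three (by positivity), Real.sqrt_div hx0, div_pow]
    field_simp
  rw [e] at h3
  refine h3.congr' ?_
  filter_upwards [eventually_ge_atTop 1] with n hn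
  have hn' : (0 : ℝ) < n := by exact_mod_cast hn
  have : √(n : ℝ) ^ 3 ≠ 0 := by positivity
  simp only [Pi.div_apply]
  rw [div_div_div_cancel_right₀ this]

/-! ### Weak convergence and the limit law. -/

/-- Probability measures on `ℝ` converge weakly if their distribution functions converge
everywhere. -/
theorem tendsto_of_forall_tendsto_cdf {ρ : ℕ → ProbabilityMeasure ℝ} {L : ProbabilityMeasure ℝ}
    (h : ∀ x, Tendsto (fun n => cdf (ρ n : Measure ℝ) x) atTop (𝓝 (cdf (L : Measure ℝ) x))) :
    Tendsto ρ atTop (𝓝 L) := by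
  set S : Set (Set ℝ) := {s | ∃ a b : ℝ, a < b ∧ Set.Ioc a b = s} with hS
  have hpi : IsPiSystem S := by
    rintro _ ⟨a, b, -, rfl⟩ _ ⟨c, d, -, rfl⟩ hne
    rw [Set.Ioc_inter_Ioc] at hne ⊢
    exact ⟨_, _, Set.nonempty_Ioc.1 hne, rfl⟩
  -- Half-open intervals form a π-system containing small neighbourhoods of every point, and their
  -- masses are differences of distribution functions.
  refine hpi.tendsto_probabilityMeasure_of_tendsto_of_mem ?_ ?_ ?_
  · rintro _ ⟨a, b, -, rfl⟩
    exact measurableSet_Ioc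
  · intro u hu x hx
    obtain ⟨ε, hε, hsub⟩ := Metric.isOpen_iff.1 hu x hx
    refine ⟨Set.Ioc (x - ε / 2) (x + ε / 2), ⟨_, _, by linarith, rfl⟩,
      Ioc_mem_nhds (by linarith) (by linarith), fun y hy => hsub ?_⟩
    rw [Metric.mem_ball, Real.dist_eq, abs_lt]
    constructor <;> linarith [hy.1, hy.2]
  · rintro _ ⟨a, b, hab, rfl⟩
    have key : ∀ Q : ProbabilityMeasure ℝ,
        ((Q (Set.Ioc a b) : NNReal) : ℝ) = cdf (Q : Measure ℝ) b - cdf (Q : Measure ℝ) a := by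
      intro Q
      rw [cdf_eq_real, cdf_eq_real, ← Set.Iic_sdiff_Iic,
        ← measureReal_sdiff (Set.Iic_subset_Iic.2 hab.le) measurableSet_Iic]
      rfl
    rw [← NNReal.tendsto_coe]
    simp_rw [key]
    exact (h b).sub (h a)

/-- The density of the limit law of the proportion of variables above the mean. -/
noncomputable def levyLimitDensity (x : ℝ) : ℝ :=
  3 / Real.pi * (√(x * (1 - x)) / (x ^ 3 + (1 - x) ^ 3))

lemma cube_add_cube_one_sub_pos (x : ℝ) : 0 < x ^ 3 + (1 - x) ^ 3 := by
  nlinarith [sq_nonneg (x - 1 / 2)]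

lemma continuous_levyLimitDensity : Continuous levyLimitDensity :=
  continuous_const.mul (Continuous.div (by fun_prop) (by fun_prop)
    fun x => (cube_add_cube_one_sub_pos x).ne')

lemma levyLimitDensity_nonneg (x : ℝ) : 0 ≤ levyLimitDensity x := by
  have := cube_add_cube_one_sub_pos x
  have := Real.pi_pos
  unfold levyLimitDensity
  positivity

/-- The real square root vanishes on nonpositive numbers, so the formula for the density needs no
cutoff. -/
lemma levyLimitDensity_eq_zero {x : ℝ} (hx : x ∉ Set.Ioo (0 : ℝ) 1) : levyLimitDensity x = 0 := by
  have : x * (1 - x) ≤ 0 := by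
    by_contra! h
    refine hx ⟨?_, ?_⟩ <;> nlinarith
  simp [levyLimitDensity, Real.sqrt_eq_zero_of_nonpos this]

/-- By this symmetry the total mass is twice the mass of `[0, 1/2]`, which avoids the singularity of
`x / (1 - x)` at `1`. -/
lemma levyLimitDensity_one_sub (x : ℝ) : levyLimitDensity (1 - x) = levyLimitDensity x := by
  unfold levyLimitDensity
  rw [sub_sub_cancel, mul_comm (1 - x) x, add_comm ((1 - x) ^ 3)]

lemma indicator_levyLimitDensity :
    (Set.Ioo (0 : ℝ) 1).indicator
      (fun x => 3 / Real.pi * (√(x * (1 - x)) / (x ^ 3 + (1 - x) ^ 3))) = levyLimitDensity :=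
  Set.indicator_eq_self.2 fun x hx => by
    by_contra h
    exact hx (levyLimitDensity_eq_zero h)

lemma hasDerivAt_arctan_rpow {x : ℝ} (hx0 : 0 < x) (hx1 : x < 1) :
    HasDerivAt (fun y => 2 / Real.pi * Real.arctan ((y / (1 - y)) ^ (3 / 2 : ℝ)))
      (levyLimitDensity x) x := by
  have h1x : 0 < 1 - x := by linarith
  have hw : 0 < x / (1 - x) := by positivity
  have h1 : HasDerivAt (fun y : ℝ => y / (1 - y)) (1 / (1 - x) ^ 2) x := by
    refine ((hasDerivAt_id' x).div ((hasDerivAt_id' x).const_sub 1) h1x.ne').congr_deriv ?_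
    ring
  refine (((h1.rpow_const (p := 3 / 2) (Or.inl hw.ne')).arctan).const_mul
    (2 / Real.pi)).congr_deriv ?_
  have e1 : ((x / (1 - x)) ^ (3 / 2 : ℝ)) ^ 2 = (x / (1 - x)) ^ 3 := by
    rw [← Real.rpow_natCast, ← Real.rpow_mul hw.le, ← Real.rpow_natCast]
    norm_num
  have e2 : (x / (1 - x)) ^ ((3 / 2 : ℝ) - 1) = √(x * (1 - x)) / (1 - x) := by
    rw [show (3 / 2 : ℝ) - 1 = 1 / 2 by norm_num, ← Real.sqrt_eq_rpow]
    have : x / (1 - x) = x * (1 - x) / (1 - x) ^ 2 := by field_simp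
    rw [this, Real.sqrt_div (by positivity), Real.sqrt_sq h1x.le]
  have h3 := cube_add_cube_one_sub_pos x
  have hpi := Real.pi_pos
  have e3 : 1 + (x / (1 - x)) ^ 3 = (x ^ 3 + (1 - x) ^ 3) / (1 - x) ^ 3 := by
    field_simp
    ring
  rw [e1, e2, e3, levyLimitDensity]
  generalize √(x * (1 - x)) = s
  generalize x ^ 3 + (1 - x) ^ 3 = d at *
  field_simp

lemma integral_levyLimitDensity {x : ℝ} (hx0 : 0 ≤ x) (hx1 : x < 1) :
    ∫ y in (0 : ℝ)..x, levyLimitDensity y =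
      2 / Real.pi * Real.arctan ((x / (1 - x)) ^ (3 / 2 : ℝ)) := by
  rw [intervalIntegral.integral_eq_sub_of_hasDerivAt_of_le hx0
    (f := fun y => 2 / Real.pi * Real.arctan ((y / (1 - y)) ^ (3 / 2 : ℝ))) ?_
    (fun y hy => hasDerivAt_arctan_rpow hy.1 (hy.2.trans hx1))
    (continuous_levyLimitDensity.intervalIntegrable _ _)]
  · simp
  · refine continuousOn_const.mul (Real.continuous_arctan.comp_continuousOn ?_)
    refine ContinuousOn.rpow_const ?_ fun y _ => Or.inr (by norm_num)
    refine continuousOn_id.div (by fun_prop) fun y hy => ?_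
    have := hy.2
    linarith

lemma integral_levyLimitDensity_zero_one : ∫ y in (0 : ℝ)..1, levyLimitDensity y = 1 := by
  have hi : ∀ a b, IntervalIntegrable levyLimitDensity volume a b :=
    fun a b => continuous_levyLimitDensity.intervalIntegrable a b
  have h1 : ∫ y in (0 : ℝ)..(1 / 2), levyLimitDensity y = 1 / 2 := by
    rw [integral_levyLimitDensity (by norm_num) (by norm_num)]
    norm_num
    have := Real.pi_ne_zero
    field_simp
    norm_num
  have h2 : ∫ y in (1 / 2 : ℝ)..1, levyLimitDensity y =
      ∫ y in (0 : ℝ)..(1 / 2), levyLimitDensity y := by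
    have := intervalIntegral.integral_comp_sub_left (a := 0) (b := 1 / 2) levyLimitDensity (1 : ℝ)
    simp only [levyLimitDensity_one_sub] at this
    rw [this]
    norm_num
  rw [← intervalIntegral.integral_add_adjacent_intervals (hi 0 (1 / 2)) (hi (1 / 2) 1), h2, h1]
  norm_num

/-- The limit law of the proportion of variables above the mean, for Lévy spacings. -/
noncomputable def levyLimitLaw : Measure ℝ :=
  volume.withDensity fun x => ENNReal.ofReal (levyLimitDensity x)

lemma levyLimitLaw_Iic {x : ℝ} (hx : 0 ≤ x) :
    levyLimitLaw (Set.Iic x) = ENNReal.ofReal (∫ y in (0 : ℝ)..x, levyLimitDensity y) := by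
  have h0 : ∫⁻ y in Set.Iic (0 : ℝ), ENNReal.ofReal (levyLimitDensity y) = 0 := by
    rw [setLIntegral_congr_fun (g := fun _ => 0) measurableSet_Iic fun y hy => ?_, lintegral_zero]
    have : y ∉ Set.Ioo (0 : ℝ) 1 := fun h => absurd hy (not_le.2 h.1)
    simp [levyLimitDensity_eq_zero this]
  rw [levyLimitLaw, withDensity_apply _ measurableSet_Iic, ← Set.Iic_union_Ioc_eq_Iic hx,
    lintegral_union measurableSet_Ioc (Set.Iic_disjoint_Ioc le_rfl), h0, zero_add,
    intervalIntegral.integral_of_le hx, ofReal_integral_eq_lintegral_ofReal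
      (continuous_levyLimitDensity.integrableOn_Ioc) (ae_of_all _ levyLimitDensity_nonneg)]

instance isProbabilityMeasure_levyLimitLaw : IsProbabilityMeasure levyLimitLaw := by
  constructor
  have h1 : levyLimitLaw (Set.Iic 1) = 1 := by
    rw [levyLimitLaw_Iic zero_le_one, integral_levyLimitDensity_zero_one, ENNReal.ofReal_one]
  have h2 : levyLimitLaw (Set.Iic 1)ᶜ = 0 := by
    rw [levyLimitLaw, withDensity_apply _ measurableSet_Iic.compl,
      setLIntegral_congr_fun (g := fun _ => 0) measurableSet_Iic.compl fun y hy => ?_,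
      lintegral_zero]
    have : y ∉ Set.Ioo (0 : ℝ) 1 := fun h => hy h.2.le
    simp [levyLimitDensity_eq_zero this]
  rw [← measure_add_measure_compl (measurableSet_Iic (a := (1 : ℝ))), h1, h2, add_zero]

lemma cdf_levyLimitLaw {x : ℝ} (hx : 0 ≤ x) :
    cdf levyLimitLaw x = ∫ y in (0 : ℝ)..x, levyLimitDensity y := by
  rw [cdf_eq_real, Measure.real, levyLimitLaw_Iic hx, ENNReal.toReal_ofReal]
  exact intervalIntegral.integral_nonneg hx fun y _ => levyLimitDensity_nonneg y

lemma cdf_levyLimitLaw_of_lt_one {x : ℝ} (hx0 : 0 ≤ x) (hx1 : x < 1) :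
    cdf levyLimitLaw x = 2 / Real.pi * Real.arctan ((x / (1 - x)) ^ (3 / 2 : ℝ)) := by
  rw [cdf_levyLimitLaw hx0, integral_levyLimitDensity hx0 hx1]

lemma cdf_levyLimitLaw_of_neg {x : ℝ} (hx : x < 0) : cdf levyLimitLaw x = 0 := by
  refine le_antisymm ((monotone_cdf _ hx.le).trans ?_) (cdf_nonneg _ _)
  rw [cdf_levyLimitLaw le_rfl, intervalIntegral.integral_same]

lemma cdf_levyLimitLaw_of_one_le {x : ℝ} (hx : 1 ≤ x) : cdf levyLimitLaw x = 1 := by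
  refine le_antisymm (cdf_le_one _ _) (le_trans ?_ (monotone_cdf _ hx))
  rw [cdf_levyLimitLaw zero_le_one, integral_levyLimitDensity_zero_one]

/-! ### Convergence in law and assembly. -/

/-- For Lévy spacings, the proportion of variables above the mean converges in law. -/
theorem tendstoInDistribution_numAboveMean_div {ν : ℕ → Measure ℝ}
    (hν : ∀ n, IsPositiveStable (1 / 2) (ν n)) {Ω : ℕ → Type*} [∀ n, MeasurableSpace (Ω n)]
    {μ : ∀ n, Measure (Ω n)} [∀ n, IsProbabilityMeasure (μ n)] {U : ∀ n, Fin n → Ω n → ℝ}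
    (hU : ∀ n, HasIIDSpacings (U n) (ν n) (μ n)) :
    TendstoInDistribution
      (fun n ω => (numAboveMean (fun i => U n i ω) : ℝ) / (n : ℝ)) atTop
      (id : ℝ → ℝ) μ levyLimitLaw := by
  have hm : ∀ n, Measurable fun ω => (numAboveMean (fun i => U n i ω) : ℝ) / (n : ℝ) := fun n =>
    ((measurable_of_countable (fun k : ℕ => (k : ℝ))).comp
      (measurable_numAboveMean (hU n).measurable)).div_const _
  refine ⟨fun n => (hm n).aemeasurable, by fun_prop, tendsto_of_forall_tendsto_cdf fun x => ?_⟩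
  have hcdf : ∀ n, cdf ((μ n).map fun ω => (numAboveMean (fun i => U n i ω) : ℝ) / (n : ℝ)) x =
      (μ n).real {ω | (numAboveMean (fun i => U n i ω) : ℝ) / (n : ℝ) ≤ x} := by
    intro n
    have := Measure.isProbabilityMeasure_map (μ := μ n) (hm n).aemeasurable
    rw [cdf_eq_real, map_measureReal_apply (hm n) measurableSet_Iic]
    rfl
  simp only [ProbabilityMeasure.coe_mk, Measure.map_id, hcdf]
  rcases lt_or_ge x 0 with hx0 | hx0
  · rw [cdf_levyLimitLaw_of_neg hx0]
    refine tendsto_const_nhds.congr fun n => ?_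
    have : {ω | (numAboveMean (fun i => U n i ω) : ℝ) / (n : ℝ) ≤ x} = ∅ := by
      refine Set.eq_empty_of_forall_notMem fun ω hω => ?_
      have h1 : (numAboveMean (fun i => U n i ω) : ℝ) / (n : ℝ) ≤ x := hω
      have h2 : 0 ≤ (numAboveMean (fun i => U n i ω) : ℝ) / (n : ℝ) := by positivity
      linarith
    rw [this, measureReal_empty]
  rcases lt_or_ge x 1 with hx1 | hx1
  · rw [cdf_levyLimitLaw_of_lt_one hx0 hx1]
    refine (((Real.continuous_arctan.tendsto _).comp
      (tendsto_sum_sqrt_ratio hx0 hx1)).const_mul (2 / Real.pi)).congr' ?_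
    -- The condition `n * (1 - x) > 1` puts `⌊x * n⌋₊` below `n - 1`, the range of the arctangent
    -- formula.
    have hlarge : ∀ᶠ n : ℕ in atTop, 1 / (1 - x) < (n : ℝ) :=
      tendsto_natCast_atTop_atTop.eventually (eventually_gt_atTop _)
    filter_upwards [hlarge, eventually_ge_atTop 1] with n hn hn1
    have hn' : (0 : ℝ) < n := by exact_mod_cast hn1
    rw [div_lt_iff₀ (by linarith)] at hn
    have hk : ⌊x * (n : ℝ)⌋₊ < n - 1 := by
      rw [Nat.floor_lt (by positivity), Nat.cast_sub hn1]
      push_cast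
      linarith
    rw [Function.comp_apply, ← measureReal_numAboveMean_le_arctan (hν n) (hU n) hk]
    congr 1
    ext ω
    change numAboveMean (fun i => U n i ω) ≤ _ ↔ (_ : ℝ) ≤ _
    rw [Nat.le_floor_iff (by positivity), div_le_iff₀ hn']
  · rw [cdf_levyLimitLaw_of_one_le hx1]
    refine tendsto_const_nhds.congr fun n => ?_
    have : {ω | (numAboveMean (fun i => U n i ω) : ℝ) / (n : ℝ) ≤ x} = Set.univ := by
      refine Set.eq_univ_of_forall fun ω => ?_
      have h1 : numAboveMean (fun i => U n i ω) ≤ n :=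
        (Finset.card_le_univ _).trans (Fintype.card_fin n).le
      exact (div_le_one_of_le₀ (by exact_mod_cast h1) (by positivity)).trans hx1
    rw [this, probReal_univ]

theorem mainTheorem3 :
    -- positive stable spacings of index `α ∈ (0, 1)`
    (∀ (α : ℝ), 0 < α → α < 1 → ∀ (ν : Measure ℝ), IsPositiveStable α ν →
      (∃ c : ℝ, 0 < c ∧ ∀ t : ℝ, 0 ≤ t →
        Integrable (fun x => Real.exp (-(t * x))) ν ∧
          ∫ x, Real.exp (-(t * x)) ∂ν = Real.exp (-(c * t ^ α))) ∧
      ∀ (n : ℕ), 2 ≤ n →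
      ∀ (Ω : Type*) [MeasurableSpace Ω] (μ : Measure Ω) [IsProbabilityMeasure μ]
        (U : Fin n → Ω → ℝ), HasIIDSpacings U ν μ →
        μ.real {ω | numAboveMean (fun i => U i ω) ≤ n - 1} = 1 ∧
        -- `D₁`, `D₂` are any two independent variables with the law of the spacings
        -- (if `n ≥ 3`, for instance the first two spacings themselves)
        ∀ (Ω' : Type*) [MeasurableSpace Ω'] (P : Measure Ω') [IsProbabilityMeasure P]
          (D₁ D₂ : Ω' → ℝ), HasLaw D₁ ν P → HasLaw D₂ ν P → IndepFun D₁ D₂ P →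
          (∀ k : ℕ, k ≤ n - 1 →
            μ.real {ω | numAboveMean (fun i => U i ω) ≤ k} =
              P.real {ω | powSum α (n - k - 1) ^ (1 / α) * D₂ ω ≤
                powSum α k ^ (1 / α) * D₁ ω}) ∧
          (∀ k : ℕ, k < n - 1 →
            μ.real {ω | numAboveMean (fun i => U i ω) ≤ k} =
              P.real {ω | D₂ ω / D₁ ω ≤ (powSum α k / powSum α (n - k - 1)) ^ (1 / α)})) ∧
    -- the Lévy case `α = 1/2`
    (∀ (ν : Measure ℝ), IsPositiveStable (1 / 2) ν → ∀ (n : ℕ), 2 ≤ n →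
      ∀ (Ω : Type*) [MeasurableSpace Ω] (μ : Measure Ω) [IsProbabilityMeasure μ]
        (U : Fin n → Ω → ℝ), HasIIDSpacings U ν μ → ∀ k : ℕ, k < n - 1 →
        μ.real {ω | numAboveMean (fun i => U i ω) ≤ k} =
          2 / Real.pi * Real.arctan
            ((∑ j ∈ Finset.Icc 1 k, √(j : ℝ)) / ∑ j ∈ Finset.Icc 1 (n - k - 1), √(j : ℝ))) ∧
    -- the limit law in the Lévy case, its distribution function and its density
    (∃ L : ProbabilityMeasure ℝ,
      (∀ x : ℝ, x < 0 → cdf (L : Measure ℝ) x = 0) ∧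
      (∀ x : ℝ, 0 ≤ x → x < 1 → cdf (L : Measure ℝ) x =
        2 / Real.pi * Real.arctan ((x / (1 - x)) ^ (3 / 2 : ℝ))) ∧
      (∀ x : ℝ, 1 ≤ x → cdf (L : Measure ℝ) x = 1) ∧
      (L : Measure ℝ) = volume.withDensity (fun x => ENNReal.ofReal
        ((Set.Ioo (0 : ℝ) 1).indicator
          (fun x => 3 / Real.pi * (√(x * (1 - x)) / (x ^ 3 + (1 - x) ^ 3))) x)) ∧
      ∀ (ν : ℕ → Measure ℝ), (∀ n, IsPositiveStable (1 / 2) (ν n)) →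
      ∀ (Ω : ℕ → Type*) [∀ n, MeasurableSpace (Ω n)] (μ : ∀ n, Measure (Ω n))
        [∀ n, IsProbabilityMeasure (μ n)] (U : ∀ n, Fin n → Ω n → ℝ),
        (∀ n, HasIIDSpacings (U n) (ν n) (μ n)) →
        TendstoInDistribution
          (fun n ω => (numAboveMean (fun i => U n i ω) : ℝ) / (n : ℝ)) atTop
          (id : ℝ → ℝ) μ (L : Measure ℝ)) := by
  refine ⟨fun α hα _ ν hν => ⟨?_, ?_⟩, ?_, ?_⟩
  · have := hν.isProbabilityMeasure
    obtain ⟨c, hc, h⟩ := hν.exists_mgf_eq hα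
    refine ⟨c, hc, fun t ht => ⟨?_, ?_⟩⟩
    · simpa only [neg_mul] using
        integrable_exp_neg_mul_of_nonneg (hν.pos.mono fun x hx => hx.le) ht
    · rw [← h t ht]
      simp only [mgf, id, neg_mul]
  · intro n hn Ω _ μ _ U hU
    refine ⟨?_, ?_⟩
    · have : {ω | numAboveMean (fun i => U i ω) ≤ n - 1} = Set.univ :=
        Set.eq_univ_of_forall fun ω => numAboveMean_le_pred (by omega) _
      rw [this, probReal_univ]
    · intro Ω' _ P _ D₁ D₂ h₁ h₂ hD
      have key : ∀ k : ℕ, k ≤ n - 1 →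
          μ.real {ω | numAboveMean (fun i => U i ω) ≤ k} =
            P.real {ω | powSum α (n - k - 1) ^ (1 / α) * D₂ ω ≤
              powSum α k ^ (1 / α) * D₁ ω} := by
        intro k hk
        obtain ⟨m, rfl⟩ : ∃ m, n = m + k + 1 := ⟨n - k - 1, by omega⟩
        rw [show m + k + 1 - k - 1 = m by omega]
        exact measureReal_numAboveMean_le hα hν hU h₁ h₂ hD
      refine ⟨key, fun k hk => ?_⟩
      rw [key k hk.le, measureReal_mul_le_mul_eq_ratio hν (by omega) h₁]
  · intro ν hν n _ Ω _ μ _ U hU k hk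
    exact measureReal_numAboveMean_le_arctan hν hU hk
  · refine ⟨⟨levyLimitLaw, inferInstance⟩, fun x => cdf_levyLimitLaw_of_neg,
      fun x => cdf_levyLimitLaw_of_lt_one, fun x => cdf_levyLimitLaw_of_one_le, ?_, ?_⟩
    · rw [indicator_levyLimitDensity]
      rfl
    · intro ν hν Ω _ μ _ U hU
      exact tendstoInDistribution_numAboveMean_div hν hU
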